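/- Let $\mathbb{K}=\bigcup_{m\ge 1}\mathbb{C}((t^{1/m}))$ be the field of complex Puiseux series, with valuation $\mathrm{val}$ the smallest exponent. For a field $F$ and a Laurent polynomial $f\in F[x^{\pm1},y^{\pm1},z^{\pm1}]$, a node of the surface $S=V(f)\subset (F^*)^3$ is a point of the torus at which $f$ and all its first partial derivatives vanish and the Hessian matrix of $f$ is nondegenerate. The surface $S$ is called binodal if it has exactly two nodes. A three-dimensional polytope $\Gamma\subset\mathbb{R}^3$ is called binodal if it is the Newton polytope of some binodal surface. For $f=\sum_a c_a x^a$ over $\mathbb{K}$, the tropical surface $\mathrm{trop}(S)\subset\mathbb{R}^3$ is the set of $w$ at which $\max_{a:\,c_a\ne0}\bigl(-\mathrm{val}(c_a)+\langle a,w\rangle\bigr)$ is attained at least twice, with its polyhedral structure dual to the induced regular subdivision of the Newton polytope; a point $p\in(\mathbb{K}^*)^3$ tropicalizes to $(-\mathrm{val}(p_1),-\mathrm{val}(p_2),-\mathrm{val}(p_3))$. **Proposition.** Let $\Gamma$ be a binodal polytope with exactly $6$ lattice points, and let $S=V(f)$ be a binodal surface over $\mathbb{K}$ with Newton polytope $\Gamma$.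 Then there is a point $v\in\mathbb{R}^3$ such that $\mathrm{trop}(S)$ is a polyhedral fan with vertex $v$ (that is, all cells of $\mathrm{trop}(S)$ are polyhedral cones with apex $v$, and $\{v\}$ is a cell), and both nodes of $S$ tropicalize to $v$. -/

import Mathlib

noncomputable section

/-! ### The field of complex Puiseux series -/

/-- The embedding `ℂ((t)) → ℂ((t^ℚ))`, `t ↦ t^(1/m)`; its range is the field `ℂ((t^(1/m)))`. -/
def ramifiedEmbedding (m : ℕ+) : HahnSeries ℤ ℂ →+* HahnSeries ℚ ℂ :=
  HahnSeries.embDomainRingHom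
    ((AddMonoidHom.mulLeft ((m : ℚ)⁻¹)).comp (Int.castAddHom ℚ))
    (fun a b h => by
      have hm : ((m : ℕ) : ℚ)⁻¹ ≠ 0 := by positivity
      simpa [hm] using h)
    (fun a b => by
      have hm : 0 < ((m : ℕ) : ℚ)⁻¹ := by positivity
      simp [mul_le_mul_iff_right₀ hm])

/-- The union over `m ≥ 1` of the fields `ℂ((t^(1/m)))`, inside the Hahn series with rational
exponents. The supremum is a directed union, see `mem_puiseuxSubfield`. -/
def puiseuxSubfield : Subfield (HahnSeries ℚ ℂ) :=
  ⨆ m : ℕ+, (ramifiedEmbedding m).fieldRange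

/-- The range of `ramifiedEmbedding m`: the Hahn series with exponents in `(1/m)ℤ`. -/
theorem mem_range_ramifiedEmbedding (m : ℕ+) (x : HahnSeries ℚ ℂ) :
    x ∈ (ramifiedEmbedding m).fieldRange ↔
      ∀ q ∈ x.support, ∃ k : ℤ, q = (m : ℚ)⁻¹ * k := by
  constructor
  · rintro ⟨y, rfl⟩ q hq
    obtain ⟨k, -, hk⟩ := HahnSeries.support_embDomain_subset hq
    exact ⟨k, hk.symm⟩
  · intro h
    have hm : 0 < ((m : ℕ) : ℚ)⁻¹ := by positivity
    have hmono : StrictMono (fun k : ℤ => (m : ℚ)⁻¹ * (k : ℚ)) := fun a b hab => by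
      have : (a : ℚ) < b := by exact_mod_cast hab
      exact mul_lt_mul_of_pos_left this hm
    have hpwo : (Function.support fun k : ℤ => x.coeff ((m : ℚ)⁻¹ * k)).IsPWO := by
      rw [Set.isPWO_iff_isWF]
      have hwf := x.isWF_support
      rw [Set.isWF_iff_no_descending_seq] at hwf ⊢
      intro g hg hmem
      exact hwf (fun n => (m : ℚ)⁻¹ * (g n : ℚ)) (fun a b hab => hmono (hg hab))
        (fun n => hmem n)
    refine ⟨⟨fun k : ℤ => x.coeff ((m : ℚ)⁻¹ * k), hpwo⟩, ?_⟩
    ext q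
    by_cases hq : ∃ k : ℤ, q = (m : ℚ)⁻¹ * k
    · obtain ⟨k, rfl⟩ := hq
      exact HahnSeries.embDomain_coeff (a := k)
    · have h0 : x.coeff q = 0 := by
        by_contra hne
        exact hq (h q hne)
      rw [h0]
      refine HahnSeries.embDomain_of_notMem_range ?_
      rintro ⟨k, hk⟩
      exact hq ⟨k, hk.symm⟩

/-- A Hahn series is a Puiseux series if and only if its exponents have a common denominator. -/
theorem mem_puiseuxSubfield (x : HahnSeries ℚ ℂ) :
    x ∈ puiseuxSubfield ↔
      ∃ m : ℕ+, ∀ q ∈ x.support, ∃ k : ℤ, q = (m : ℚ)⁻¹ * k := by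
  have hdir : Directed (· ≤ ·) fun m : ℕ+ => (ramifiedEmbedding m).fieldRange := by
    intro a b
    refine ⟨a * b, fun x hx => ?_, fun x hx => ?_⟩
    · rw [mem_range_ramifiedEmbedding] at hx ⊢
      intro q hq
      obtain ⟨k, rfl⟩ := hx q hq
      refine ⟨k * (b : ℕ), ?_⟩
      have := b.ne_zero
      push_cast
      field_simp
    · rw [mem_range_ramifiedEmbedding] at hx ⊢
      intro q hq
      obtain ⟨k, rfl⟩ := hx q hq
      refine ⟨k * (a : ℕ), ?_⟩
      have := a.ne_zero
      push_cast
      field_simp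
  unfold puiseuxSubfield
  rw [Subfield.mem_iSup_of_directed hdir]
  simp only [mem_range_ramifiedEmbedding]

/-- The field `𝕂 = ⋃_{m ≥ 1} ℂ((t^(1/m)))` of complex Puiseux series. -/
abbrev PuiseuxSeries : Type := puiseuxSubfield

/-- The valuation of a nonzero Puiseux series: its smallest exponent. (The value at `0` is
junk; it is only used for nonzero arguments.) -/
def puiseuxVal (x : PuiseuxSeries) : ℚ := (x : HahnSeries ℚ ℂ).order

/-! ### Surfaces in the three-dimensional torus and their nodes -/

/-- Laurent polynomials in three variables; the coefficient of `x^a` is `f.coeff a`. -/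
abbrev LaurentPoly (F : Type*) [Field F] : Type _ := AddMonoidAlgebra F (Fin 3 → ℤ)

/-- The value of a Laurent polynomial at a point of the torus `(Fˣ)³`. -/
def evalTorus {F : Type*} [Field F] (p : Fin 3 → Fˣ) (f : LaurentPoly F) : F :=
  f.coeff.sum fun a c => c * ((∏ i, p i ^ a i : Fˣ) : F)

/-- The partial derivative `∂f/∂xᵢ` of a Laurent polynomial. -/
def partialDeriv {F : Type*} [Field F] (i : Fin 3) (f : LaurentPoly F) : LaurentPoly F :=
  f.coeff.sum fun a c => AddMonoidAlgebra.single (a - Pi.single i 1) ((a i : F) * c)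

/-- The torus point `p` is a node (ordinary double point) of the surface `f = 0`: it is a
singular point at which the Hessian matrix is nondegenerate. -/
structure IsNode {F : Type*} [Field F] (f : LaurentPoly F) (p : Fin 3 → Fˣ) : Prop where
  eval_eq_zero : evalTorus p f = 0
  deriv_eq_zero : ∀ i, evalTorus p (partialDeriv i f) = 0
  hessian_ne_zero :
    (Matrix.of fun i j => evalTorus p (partialDeriv i (partialDeriv j f))).det ≠ 0

/-- The surface `f = 0` in the torus is binodal: it has exactly two nodes. -/
def IsBinodal {F : Type*} [Field F] (f : LaurentPoly F) : Prop :=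
  {p : Fin 3 → Fˣ | IsNode f p}.ncard = 2

/-- The inclusion `ℤ³ → ℝ³`. -/
def latticePoint (a : Fin 3 → ℤ) : Fin 3 → ℝ := fun i => (a i : ℝ)

/-- The Newton polytope: the convex hull of the exponents with nonzero coefficient. -/
def newtonPolytope {F : Type*} [Field F] (f : LaurentPoly F) : Set (Fin 3 → ℝ) :=
  convexHull ℝ (latticePoint '' (f.coeff.support : Set (Fin 3 → ℤ)))

/-- `Γ` is a binodal polytope (over the field `F`): it is three-dimensional and it is the Newton
polytope of a binodal surface. -/
def IsBinodalPolytope (F : Type*) [Field F] (Γ : Set (Fin 3 → ℝ)) : Prop :=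
  affineSpan ℝ Γ = ⊤ ∧ ∃ g : LaurentPoly F, newtonPolytope g = Γ ∧ IsBinodal g

/-! ### Tropicalization (max-convention) -/

/-- The tropicalization `(-val p₁, -val p₂, -val p₃)` of a point of the torus. -/
def tropPoint (p : Fin 3 → PuiseuxSeriesˣ) : Fin 3 → ℝ :=
  fun i => -((puiseuxVal (p i : PuiseuxSeries) : ℚ) : ℝ)

/-- The value at `w` of the tropical monomial belonging to the exponent `a`. -/
def tropTerm (f : LaurentPoly PuiseuxSeries) (w : Fin 3 → ℝ) (a : Fin 3 → ℤ) : ℝ :=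
  -((puiseuxVal (f.coeff a) : ℚ) : ℝ) + ∑ i, (a i : ℝ) * w i

open Classical in
/-- The exponents at which the maximum defining `trop(f)(w)` is attained. -/
def maxTerms (f : LaurentPoly PuiseuxSeries) (w : Fin 3 → ℝ) : Finset (Fin 3 → ℤ) :=
  f.coeff.support.filter fun a => ∀ b ∈ f.coeff.support, tropTerm f w b ≤ tropTerm f w a

/-- The tropical surface as a set: the points where the maximum is attained at least twice. -/
def tropicalSurface (f : LaurentPoly PuiseuxSeries) : Set (Fin 3 → ℝ) :=
  {w | 2 ≤ (maxTerms f w).card}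

/-- The smallest closed cell containing `w` in the polyhedral complex given by the domains of
linearity of `trop(f)`. -/
def tropicalCell (f : LaurentPoly PuiseuxSeries) (w : Fin 3 → ℝ) : Set (Fin 3 → ℝ) :=
  {u | maxTerms f w ⊆ maxTerms f u}

/-- The tropical surface as a polyhedral complex (the one dual to the regular subdivision of the
Newton polytope), given as the set of its nonempty closed cells. -/
def tropicalComplex (f : LaurentPoly PuiseuxSeries) : Set (Set (Fin 3 → ℝ)) :=
  tropicalCell f '' tropicalSurface f

/-- The collection `C` of nonempty cells is a polyhedral fan whose vertex is `v`, that is, after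
translating `v` to the origin it is a fan of polyhedral cones, and `{v}` is one of its cones. -/
structure IsFanWithVertex (C : Set (Set (Fin 3 → ℝ))) (v : Fin 3 → ℝ) : Prop where
  finite : C.Finite
  /-- Every cell is a polyhedral cone with apex `v`. -/
  cone : ∀ σ ∈ C, ∃ N : Finset (Fin 3 → ℝ), σ = {w | ∀ n ∈ N, n ⬝ᵥ (w - v) ≤ 0}
  /-- Every nonempty face of a cell is a cell. -/
  face_mem : ∀ σ ∈ C, ∀ τ : Set (Fin 3 → ℝ), τ.Nonempty → IsExposed ℝ σ τ → τ ∈ C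
  /-- Two cells meet in a common face. -/
  inter_face : ∀ σ ∈ C, ∀ τ ∈ C, IsExposed ℝ σ (σ ∩ τ) ∧ IsExposed ℝ τ (σ ∩ τ)
  vertex_mem : {v} ∈ C

end

/-!
Let `A` be the support of `f`, let `p` and `q = p * s` be the two nodes, and let `u a` and `v a` be
the values of the term with exponent `a` at `p` and at `q`. The node conditions say that `u` and `v`
are affine dependences of `A` without zeros and that the quadratic form `∑ₐ u a * (n ⬝ a)²` is
nondegenerate (`isNode_iff_isNodalWeight`). As `A` spans and has at most six points, its affine
dependences form a space of dimension at most two (`finrank_ker_momentMap`).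

It suffices to show that all `u a` have the same valuation, and likewise all `v a`. Then all tropical
terms agree at the tropicalization of each node; since `A` spans, this can happen at one point only,
and `isFanWithVertex_of_tropTerm_eq` shows that this point is the vertex of a fan.

Suppose first that `u` and `v` span the affine dependences of `A`. Let `D = t d/dt`. Since
`v a / u a = s ^ a`, the functions `D u / u` and `D v / v` differ by a linear function of `a`.
Pairing with `v` shows that `D u / u` is orthogonal to `v`; it is also orthogonal to `u`, because
`∑ₐ D (u a) = 0`. Hence it is orthogonal to all affine dependences, so it is an affine function of
`a`. As `D u` is again an affine dependence, the linear part of this function lies in the kernel of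
the quadratic form and vanishes. So `D u = c • u`, the quotients `u a / u b` lie in `ℂ`, and the
valuations agree (`IsNodalWeight.exists_derivation_eq`).

Otherwise `A` consists of all six lattice points of the polytope and `s ^ a` is constant on `A`.
Then `q * s` is a node too, so `s ^ 2 = 1`, and `A` meets at most four classes modulo `2`. Midpoints
of congruent points belong to `A`. This forces either five coplanar points, impossible since the
sixth would not occur in any dependence, or two segments with their midpoints, for which the
quadratic form is degenerate (`IsNodalWeight.false_of_character_const`).
-/

/-! ### Nodes in terms of the values of the monomials -/

/-- The value at the torus point `p` of the term of `f` with exponent `a`. -/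
def torusTerm {F : Type*} [Field F] (f : LaurentPoly F) (p : Fin 3 → Fˣ) (a : Fin 3 → ℤ) : F :=
  f.coeff a * ((∏ i, p i ^ a i : Fˣ) : F)

/-- The function `u` on the finite set `A ⊆ ℤ³` consists of the values at a node of the terms of a
Laurent polynomial with support `A`, expressed through logarithmic derivatives: `u` is an affine
dependence with full support, and the quadratic form `∑ₐ u a * (n ⬝ a)²` in `n` is nondegenerate. -/
structure IsNodalWeight {F : Type*} [Field F] (A : Finset (Fin 3 → ℤ)) (u : (Fin 3 → ℤ) → F) :
    Prop where
  ne_zero : ∀ a ∈ A, u a ≠ 0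
  sum_eq_zero : ∑ a ∈ A, u a = 0
  sum_mul_eq_zero : ∀ i, ∑ a ∈ A, u a * (a i : F) = 0
  nondegenerate : ∀ n : Fin 3 → F,
    (∀ j, ∑ a ∈ A, u a * (a j : F) * ∑ i, n i * (a i : F) = 0) → n = 0

section Nodes

variable {F : Type*} [Field F]

theorem torusTerm_ne_zero (f : LaurentPoly F) (p : Fin 3 → Fˣ) {a : Fin 3 → ℤ}
    (ha : a ∈ f.coeff.support) : torusTerm f p a ≠ 0 :=
  mul_ne_zero (Finsupp.mem_support_iff.mp ha) (Units.ne_zero _)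

theorem torusTerm_mul (f : LaurentPoly F) (p s : Fin 3 → Fˣ) (a : Fin 3 → ℤ) :
    torusTerm f (p * s) a = torusTerm f p a * ((∏ i, s i ^ a i : Fˣ) : F) := by
  simp only [torusTerm, Pi.mul_apply, mul_zpow, Finset.prod_mul_distrib, Units.val_mul]
  ring

theorem prod_zpow_sub_single (p : Fin 3 → Fˣ) (a : Fin 3 → ℤ) (i : Fin 3) :
    (∏ k, p k ^ (a - Pi.single i 1 : Fin 3 → ℤ) k) = (p i)⁻¹ * ∏ k, p k ^ a k := by
  simp only [Pi.sub_apply, zpow_sub, Finset.prod_mul_distrib, Finset.prod_inv_distrib]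
  rw [mul_comm, Finset.prod_eq_single (s := Finset.univ) i]
  · simp
  · intro b _ hb
    simp [Pi.single_eq_of_ne hb]
  · simp

theorem sum_partialDeriv (i : Fin 3) (f : LaurentPoly F) (g : (Fin 3 → ℤ) → F →+ F) :
    ((partialDeriv i f).coeff.sum fun a c => g a c) =
      f.coeff.sum fun a c => g (a - Pi.single i 1) ((a i : F) * c) := by
  unfold partialDeriv
  rw [AddMonoidAlgebra.coeff_finsuppSum, Finsupp.sum_sum_index (by simp) (by simp)]
  refine Finsupp.sum_congr fun a _ => ?_
  rw [AddMonoidAlgebra.coeff_single, Finsupp.sum_single_index (by simp)]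

theorem evalTorus_partialDeriv (p : Fin 3 → Fˣ) (i : Fin 3) (f : LaurentPoly F) :
    evalTorus p (partialDeriv i f) =
      ((p i)⁻¹ : Fˣ) * ∑ a ∈ f.coeff.support, torusTerm f p a * (a i : F) := by
  have := sum_partialDeriv i f
    (fun a => AddMonoidHom.mulRight ((∏ k, p k ^ a k : Fˣ) : F))
  simp only [AddMonoidHom.mulRight_apply, prod_zpow_sub_single] at this
  unfold evalTorus
  rw [this, Finsupp.sum, Finset.mul_sum]
  refine Finset.sum_congr rfl fun a _ => ?_
  simp only [torusTerm, Units.val_mul]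
  ring

theorem evalTorus_partialDeriv_partialDeriv (p : Fin 3 → Fˣ) (i j : Fin 3) (f : LaurentPoly F) :
    evalTorus p (partialDeriv i (partialDeriv j f)) =
      ((p i)⁻¹ : Fˣ) * (((p j)⁻¹ : Fˣ) *
        (∑ a ∈ f.coeff.support, torusTerm f p a * (a i : F) * (a j : F) -
          if i = j then ∑ a ∈ f.coeff.support, torusTerm f p a * (a j : F) else 0)) := by
  have h1 := sum_partialDeriv i (partialDeriv j f)
    (fun a => AddMonoidHom.mulRight ((∏ k, p k ^ a k : Fˣ) : F))
  have h2 := sum_partialDeriv j f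
    (fun a => (AddMonoidHom.mulRight ((((p i)⁻¹ * ∏ k, p k ^ a k : Fˣ) : F))).comp
      (AddMonoidHom.mulLeft (a i : F)))
  simp only [AddMonoidHom.mulRight_apply, AddMonoidHom.comp_apply, AddMonoidHom.coe_mulLeft,
    prod_zpow_sub_single] at h1 h2
  unfold evalTorus
  rw [h1, h2, Finsupp.sum]
  have h3 : (if i = j then ∑ a ∈ f.coeff.support, torusTerm f p a * (a j : F) else 0) =
      ∑ a ∈ f.coeff.support, if i = j then torusTerm f p a * (a j : F) else 0 := by
    split_ifs <;> simp
  rw [h3, ← Finset.sum_sub_distrib, Finset.mul_sum, Finset.mul_sum]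
  refine Finset.sum_congr rfl fun a _ => ?_
  simp only [torusTerm, Units.val_mul]
  by_cases hij : i = j
  · subst hij
    simp
    ring
  · simp [hij]
    ring

/-- A torus point is a node of `f = 0` if and only if the values of the terms of `f` there are a
nodal weight: at a singular point the Hessian differs from the matrix of
`n ↦ ∑ₐ u a * (n ⬝ a)²` only by an invertible diagonal congruence. -/
theorem isNode_iff_isNodalWeight (f : LaurentPoly F) (p : Fin 3 → Fˣ) :
    IsNode f p ↔ IsNodalWeight f.coeff.support (torusTerm f p) := by
  set A := f.coeff.support with hA
  set u := torusTerm f p with hu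
  have hderiv : (∀ i, evalTorus p (partialDeriv i f) = 0) ↔
      ∀ i, ∑ a ∈ A, u a * (a i : F) = 0 := by
    refine forall_congr' fun i => ?_
    rw [evalTorus_partialDeriv]
    exact mul_eq_zero_iff_left (Units.ne_zero _)
  have hhess : (∀ i, ∑ a ∈ A, u a * (a i : F) = 0) →
      ((Matrix.of fun i j => evalTorus p (partialDeriv i (partialDeriv j f))).det ≠ 0 ↔
      ∀ n : Fin 3 → F, (∀ j, ∑ a ∈ A, u a * (a j : F) * ∑ i, n i * (a i : F) = 0) → n = 0) := by
    intro hz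
    have hmat : (Matrix.of fun i j => evalTorus p (partialDeriv i (partialDeriv j f))) =
        Matrix.diagonal (fun i => (((p i)⁻¹ : Fˣ) : F)) *
          (Matrix.of fun i j => ∑ a ∈ A, u a * (a i : F) * (a j : F)) *
          Matrix.diagonal (fun i => (((p i)⁻¹ : Fˣ) : F)) := by
      ext i j
      rw [Matrix.mul_diagonal, Matrix.diagonal_mul, Matrix.of_apply, Matrix.of_apply,
        evalTorus_partialDeriv_partialDeriv, hz j]
      simp only [ite_self, sub_zero]
      ring
    have hdiag : (Matrix.diagonal (fun i => (((p i)⁻¹ : Fˣ) : F))).det ≠ 0 := by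
      rw [Matrix.det_diagonal]
      exact Finset.prod_ne_zero_iff.mpr fun i _ => Units.ne_zero _
    rw [hmat, Matrix.det_mul, Matrix.det_mul, mul_ne_zero_iff, mul_ne_zero_iff]
    simp only [hdiag, ne_eq, not_false_eq_true, and_true, true_and]
    rw [← Matrix.exists_mulVec_eq_zero_iff]
    push Not
    refine forall_congr' fun n => ?_
    have hmul : (Matrix.of fun i j => ∑ a ∈ A, u a * (a i : F) * (a j : F)).mulVec n =
        fun j => ∑ a ∈ A, u a * (a j : F) * ∑ i, n i * (a i : F) := by
      funext j
      simp only [Matrix.mulVec, dotProduct, Matrix.of_apply, Finset.sum_mul, Finset.mul_sum]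
      rw [Finset.sum_comm]
      exact Finset.sum_congr rfl fun a _ => Finset.sum_congr rfl fun i _ => by ring
    rw [hmul]
    exact ⟨fun h hz => by_contra fun hn => h hn (funext hz),
      fun h hn hz => hn (h (congrFun hz))⟩
  constructor
  · rintro ⟨h0, h1, h2⟩
    have h1' := hderiv.mp h1
    exact ⟨fun a ha => torusTerm_ne_zero f p ha, h0, h1', (hhess h1').mp h2⟩
  · rintro ⟨-, h0, h1, h2⟩
    exact ⟨h0, hderiv.mpr h1, (hhess h1).mpr h2⟩

end Nodes

/-! ### Affine spanning -/

/-- The set `A ⊆ ℤ³` affinely spans `F³`: no nonzero linear form is constant on `A`. -/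
def AffinelySpans (F : Type*) [Field F] (A : Finset (Fin 3 → ℤ)) : Prop :=
  ∀ (n : Fin 3 → F) (c : F), (∀ a ∈ A, ∑ i, n i * (a i : F) = c) → n = 0

theorem AffinelySpans.nonempty {F : Type*} [Field F] {A : Finset (Fin 3 → ℤ)}
    (h : AffinelySpans F A) : A.Nonempty := by
  rw [Finset.nonempty_iff_ne_empty]
  rintro rfl
  have := h (fun _ => 1) 0 (by simp)
  exact one_ne_zero (congrFun this 0)

theorem affinelySpans_real {A : Finset (Fin 3 → ℤ)}
    (h : affineSpan ℝ (latticePoint '' (A : Set (Fin 3 → ℤ))) = ⊤) : AffinelySpans ℝ A := by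
  intro n c hn
  have key : ∀ x : Fin 3 → ℝ, ∑ i, n i * x i = c := by
    intro x
    have hx : x ∈ affineSpan ℝ (latticePoint '' (A : Set (Fin 3 → ℤ))) := h ▸ trivial
    refine affineSpan_induction (p := fun x => ∑ i, n i * x i = c) hx ?_ ?_
    · rintro _ ⟨a, ha, rfl⟩
      exact hn a ha
    · intro k u v w hu hv hw
      simp only [vsub_eq_sub, vadd_eq_add, Fin.sum_univ_three, Pi.add_apply, Pi.smul_apply,
        Pi.sub_apply, smul_eq_mul] at hu hv hw ⊢
      linear_combination k * hu - k * hv + hw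
  have hc : c = 0 := by simpa using (key 0).symm
  ext i
  simpa [Pi.single_apply, hc] using key (Pi.single i 1)

/-- Affine spanning passes from `ℝ` to Puiseux series: compare real and imaginary parts of
coefficients. -/
theorem AffinelySpans.puiseuxSeries {A : Finset (Fin 3 → ℤ)} (h : AffinelySpans ℝ A) :
    AffinelySpans PuiseuxSeries A := by
  intro n c hn
  have hcoeff : ∀ q : ℚ, ∀ a ∈ A,
      ∑ i, (n i : HahnSeries ℚ ℂ).coeff q * (a i : ℂ) = (c : HahnSeries ℚ ℂ).coeff q := by
    intro q a ha
    rw [← hn a ha]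
    push_cast
    rw [HahnSeries.coeff_sum]
    refine Finset.sum_congr rfl fun i _ => ?_
    rw [mul_comm (n i : HahnSeries ℚ ℂ), ← zsmul_eq_mul, HahnSeries.coeff_smul, zsmul_eq_mul,
      mul_comm]
  ext i q
  have hre := h (fun i => ((n i : HahnSeries ℚ ℂ).coeff q).re)
    ((c : HahnSeries ℚ ℂ).coeff q).re fun a ha => by
      simpa using congrArg Complex.re (hcoeff q a ha)
  have him := h (fun i => ((n i : HahnSeries ℚ ℂ).coeff q).im)
    ((c : HahnSeries ℚ ℂ).coeff q).im fun a ha => by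
      simpa using congrArg Complex.im (hcoeff q a ha)
  exact Complex.ext (congrFun hre i) (congrFun him i)

theorem AffinelySpans.of_affineSpan_newtonPolytope {F : Type*} [Field F] {f : LaurentPoly F}
    (h : affineSpan ℝ (newtonPolytope f) = ⊤) : AffinelySpans ℝ f.coeff.support := by
  rw [newtonPolytope, affineSpan_convexHull] at h
  exact affinelySpans_real h

/-! ### Rigidity of a pair of nodes -/

section Rigidity

variable {F : Type*} [Field F]

/-- The map sending a weight `y` on `A` to its total mass and its first moments. -/
def momentMap (A : Finset (Fin 3 → ℤ)) : (A → F) →ₗ[F] F × (Fin 3 → F) where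
  toFun y := (∑ a, y a, fun i => ∑ a, y a * (a.1 i : F))
  map_add' x y := by
    ext <;> simp [Finset.sum_add_distrib, add_mul]
  map_smul' c y := by
    ext <;> simp [Finset.mul_sum, mul_assoc]

theorem mem_ker_momentMap {A : Finset (Fin 3 → ℤ)} {y : (Fin 3 → ℤ) → F} :
    (fun a : A => y a) ∈ LinearMap.ker (momentMap (F := F) A) ↔
      ∑ a ∈ A, y a = 0 ∧ ∀ i, ∑ a ∈ A, y a * (a i : F) = 0 := by
  rw [LinearMap.mem_ker, Prod.ext_iff, funext_iff]
  simp only [momentMap, LinearMap.coe_mk, AddHom.coe_mk, Prod.fst_zero, Prod.snd_zero,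
    Pi.zero_apply]
  rw [← Finset.sum_coe_sort A]
  simp only [← Finset.sum_coe_sort A]

theorem momentMap_single {A : Finset (Fin 3 → ℤ)} [DecidableEq A] (a : A) :
    momentMap (F := F) A (Pi.single a 1) = (1, fun i => (a.1 i : F)) := by
  ext <;> simp [momentMap, Pi.single_apply]

theorem linearMap_prod_apply (g : F × (Fin 3 → F) →ₗ[F] F) (x : F) (n : Fin 3 → F) :
    g (x, n) = x * g (1, 0) + ∑ i, n i * g (0, Pi.single i 1) := by
  have h : (x, n) = x • ((1, 0) : F × (Fin 3 → F)) +
      ∑ i, n i • ((0, Pi.single i 1) : F × (Fin 3 → F)) := by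
    ext i
    · simp [Prod.fst_sum]
    · simp [Prod.snd_sum, Finset.sum_apply, Pi.single_apply]
  conv_lhs => rw [h]
  rw [map_add, map_smul, map_sum, smul_eq_mul]
  simp only [map_smul, smul_eq_mul]

/-- A weight on `A` orthogonal to all affine dependences of `A` is an affine function. -/
theorem exists_affine_of_forall_ker (A : Finset (Fin 3 → ℤ)) (w : (Fin 3 → ℤ) → F)
    (hw : ∀ y ∈ LinearMap.ker (momentMap (F := F) A), ∑ a, w a.1 * y a = 0) :
    ∃ (c : F) (n : Fin 3 → F), ∀ a ∈ A, w a = c + ∑ i, n i * (a i : F) := by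
  classical
  let θ : (A → F) →ₗ[F] F := ∑ a : A, w a.1 • LinearMap.proj a
  have hθ : ∀ y, θ y = ∑ a, w a.1 * y a := fun y => by simp [θ]
  have hmem : θ ∈ LinearMap.range (momentMap (F := F) A).dualMap := by
    rw [LinearMap.range_dualMap_eq_dualAnnihilator_ker, Submodule.mem_dualAnnihilator]
    intro y hy
    rw [hθ]
    exact hw y hy
  obtain ⟨g, hg⟩ := hmem
  refine ⟨g (1, 0), fun i => g (0, Pi.single i 1), fun a ha => ?_⟩
  have h1 := hθ (Pi.single ⟨a, ha⟩ 1)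
  rw [← hg, LinearMap.dualMap_apply] at h1
  rw [momentMap_single, linearMap_prod_apply] at h1
  simp only [Pi.single_apply, mul_ite, mul_one, mul_zero, Finset.sum_ite_eq', Finset.mem_univ,
    if_true] at h1
  rw [← h1]
  simp [mul_comm]

/-- The affine dependences of an affinely spanning set `A ⊆ ℤ³` form a space of dimension
`|A| - 4`. -/
theorem finrank_ker_momentMap {A : Finset (Fin 3 → ℤ)} (hA : AffinelySpans F A) (hne : A.Nonempty) :
    Module.finrank F (LinearMap.ker (momentMap (F := F) A)) + 4 = A.card := by
  classical
  have hsurj : LinearMap.range (momentMap (F := F) A) = ⊤ := by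
    by_contra hlt
    obtain ⟨g, hg0, hg⟩ := Submodule.exists_le_ker_of_lt_top _ (lt_top_iff_ne_top.mpr hlt)
    have hval : ∀ a ∈ A, g (1, 0) + ∑ i, (a i : F) * g (0, Pi.single i 1) = 0 := by
      intro a ha
      have := hg (LinearMap.mem_range_self (momentMap (F := F) A) (Pi.single ⟨a, ha⟩ 1))
      rw [LinearMap.mem_ker, momentMap_single, linearMap_prod_apply, one_mul] at this
      exact this
    have hn := hA (fun i => g (0, Pi.single i 1)) (-g (1, 0)) fun a ha => by
      have := hval a ha
      simp only [mul_comm (g _)]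
      linear_combination this
    obtain ⟨a, ha⟩ := hne
    have h1 := hval a ha
    simp only [congrFun hn, Pi.zero_apply, mul_zero, Finset.sum_const_zero, add_zero] at h1
    refine hg0 (LinearMap.ext fun ⟨x, n⟩ => ?_)
    rw [linearMap_prod_apply, h1]
    simp [congrFun hn]
  have := LinearMap.finrank_range_add_finrank_ker (momentMap (F := F) A)
  rw [hsurj] at this
  simp at this
  omega

/-- An additive map satisfying the Leibniz rule, as a derivation. -/
def derivationOfLeibniz (D : F →+ F) (hD : ∀ x y, D (x * y) = x * D y + y * D x) :
    Derivation ℤ F F :=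
  Derivation.mk' D.toIntLinearMap hD

theorem leibniz_mul_intCast (D : F →+ F) (hD : ∀ x y, D (x * y) = x * D y + y * D x)
    (x : F) (k : ℤ) : D (x * k) = D x * k := by
  have h := (derivationOfLeibniz D hD).map_intCast k
  rw [hD, show D (k : F) = 0 from h, mul_zero, zero_add, mul_comm]

theorem leibniz_div_eq_zero (D : F →+ F) (hD : ∀ x y, D (x * y) = x * D y + y * D x) {x y c : F}
    (hx : D x = c * x) (hy : D y = c * y) : D (x / y) = 0 := by
  refine ((derivationOfLeibniz D hD).leibniz_div x y).trans ?_
  rw [show derivationOfLeibniz D hD x = _ from hx, show derivationOfLeibniz D hD y = _ from hy,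
    smul_eq_mul, smul_eq_mul]
  ring

theorem leibniz_prod_zpow (D : F →+ F) (hD : ∀ x y, D (x * y) = x * D y + y * D x)
    (s : Fin 3 → Fˣ) (a : Fin 3 → ℤ) :
    D ((∏ i, s i ^ a i : Fˣ) : F) =
      ((∏ i, s i ^ a i : Fˣ) : F) * ∑ i, (a i : F) * (D (s i : F) / (s i : F)) := by
  have h : ∀ (x : Fˣ) (k : ℤ), D ((x ^ k : Fˣ) : F) = ((x ^ k : Fˣ) : F) * (k * (D x / x)) := by
    intro x k
    have hx : (x : F) ≠ 0 := x.ne_zero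
    have hk : D ((x : F) ^ k) = k • (x : F) ^ (k - 1) • D x :=
      (derivationOfLeibniz D hD).leibniz_zpow (x : F) k
    rw [Units.val_zpow_eq_zpow_val, hk, zpow_sub_one₀ hx, zsmul_eq_mul, smul_eq_mul]
    ring
  simp only [Fin.prod_univ_three, Fin.sum_univ_three, Units.val_mul, hD, h]
  ring

/-- Suppose a torus translation carries the nodal weight `u` to a weight `v`, and `u`, `v` together
span the dependences of `A`. Then all derivations act on `u` through a common factor. Indeed the
logarithmic derivatives of `u` and `v` differ by an affine function, so that of `u` is orthogonal to
`u` and `v`, hence affine itself; its linear part lies in the kernel of the nondegenerate form. -/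
theorem IsNodalWeight.exists_derivation_eq {A : Finset (Fin 3 → ℤ)} {u v : (Fin 3 → ℤ) → F}
    (hu : IsNodalWeight A u) (hv : IsNodalWeight A v)
    (hspan : LinearMap.ker (momentMap (F := F) A) ≤
      Submodule.span F {(fun a : A => u a), (fun a : A => v a)})
    (s : Fin 3 → Fˣ) (hs : ∀ a ∈ A, v a = u a * ((∏ i, s i ^ a i : Fˣ) : F))
    (D : F →+ F) (hD : ∀ x y, D (x * y) = x * D y + y * D x) :
    ∃ c : F, ∀ a ∈ A, D (u a) = c * u a := by
  have hDu : ∑ a ∈ A, D (u a) = 0 := by rw [← map_sum, hu.sum_eq_zero, map_zero]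
  have hDv : ∑ a ∈ A, D (v a) = 0 := by rw [← map_sum, hv.sum_eq_zero, map_zero]
  have hDu' : ∀ j, ∑ a ∈ A, D (u a) * (a j : F) = 0 := by
    intro j
    rw [← map_zero D, ← hu.sum_mul_eq_zero j, map_sum]
    refine Finset.sum_congr rfl fun a _ => ?_
    rw [leibniz_mul_intCast D hD]
  let θ : (A → F) →ₗ[F] F := ∑ a : A, (D (u a.1) / u a.1) • LinearMap.proj a
  have hθ : ∀ y, θ y = ∑ a : A, (D (u a.1) / u a.1) * y a := fun y => by simp [θ]
  have hle : LinearMap.ker (momentMap (F := F) A) ≤ LinearMap.ker θ := by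
    refine hspan.trans (Submodule.span_le.mpr ?_)
    rintro y (rfl | rfl)
    · rw [SetLike.mem_coe, LinearMap.mem_ker, hθ,
        Finset.sum_coe_sort A (fun a => D (u a) / u a * u a), ← hDu]
      exact Finset.sum_congr rfl fun a ha => div_mul_cancel₀ _ (hu.ne_zero a ha)
    · rw [SetLike.mem_coe, LinearMap.mem_ker, hθ,
        Finset.sum_coe_sort A (fun a => D (u a) / u a * v a)]
      have h : ∀ a ∈ A, D (u a) / u a * v a =
          D (v a) - ∑ i, v a * (a i : F) * (D (s i : F) / (s i : F)) := by
        intro a ha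
        have hua := hu.ne_zero a ha
        have hsum : ∑ i, v a * (a i : F) * (D (s i : F) / (s i : F)) =
            v a * ∑ i, (a i : F) * (D (s i : F) / (s i : F)) := by
          simp only [Finset.mul_sum, mul_assoc]
        rw [hsum, hs a ha, hD, leibniz_prod_zpow D hD]
        field_simp
        ring
      rw [Finset.sum_congr rfl h, Finset.sum_sub_distrib, hDv, Finset.sum_comm]
      simp only [← Finset.sum_mul, hv.sum_mul_eq_zero, zero_mul, Finset.sum_const_zero, sub_zero]
  obtain ⟨c, n, hn⟩ := exists_affine_of_forall_ker A (fun a => D (u a) / u a) fun y hy => by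
    rw [← hθ]
    exact hle hy
  have hDeq : ∀ a ∈ A, D (u a) = c * u a + u a * ∑ i, n i * (a i : F) := by
    intro a ha
    have := hn a ha
    rw [div_eq_iff (hu.ne_zero a ha)] at this
    rw [this]
    ring
  have hn0 : n = 0 := by
    refine hu.nondegenerate n fun j => ?_
    rw [← hDu' j]
    have h : ∀ a ∈ A, D (u a) * (a j : F) =
        c * (u a * (a j : F)) + u a * (a j : F) * ∑ i, n i * (a i : F) := by
      intro a ha
      rw [hDeq a ha]
      ring
    rw [Finset.sum_congr rfl h, Finset.sum_add_distrib, ← Finset.mul_sum, hu.sum_mul_eq_zero j,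
      mul_zero, zero_add]
  refine ⟨c, fun a ha => ?_⟩
  rw [hDeq a ha, hn0]
  simp

/-- If `A` affinely spans and has at most six points, then either two nodal weights span the
dependences of `A`, or `A` has exactly six points and the weights are proportional. -/
theorem IsNodalWeight.ker_le_span_or_proportional {A : Finset (Fin 3 → ℤ)} {u v : (Fin 3 → ℤ) → F}
    (hA : AffinelySpans F A) (hcard : A.card ≤ 6) (hu : IsNodalWeight A u)
    (hv : IsNodalWeight A v) :
    LinearMap.ker (momentMap (F := F) A) ≤
      Submodule.span F {(fun a : A => u a), (fun a : A => v a)} ∨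
    (A.card = 6 ∧ ∃ k : F, ∀ a ∈ A, v a = k * u a) := by
  have hne := hA.nonempty
  have hfin := finrank_ker_momentMap hA hne
  have hu' := mem_ker_momentMap.mpr ⟨hu.sum_eq_zero, hu.sum_mul_eq_zero⟩
  have hv' := mem_ker_momentMap.mpr ⟨hv.sum_eq_zero, hv.sum_mul_eq_zero⟩
  set K := LinearMap.ker (momentMap (F := F) A)
  set U : A → F := fun a => u a
  set V : A → F := fun a => v a
  have hspanK : Submodule.span F {U, V} ≤ K := Submodule.span_le.mpr (by
    rintro y (rfl | rfl)
    exacts [hu', hv'])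
  have hU : U ≠ 0 := by
    obtain ⟨a, ha⟩ := hne
    exact fun h => hu.ne_zero a ha (congrFun h ⟨a, ha⟩)
  by_cases hli : LinearIndependent F ![U, V]
  · left
    have h2 : Module.finrank F (Submodule.span F {U, V}) = 2 := by
      have := finrank_span_eq_card hli
      rwa [Matrix.range_cons, Matrix.range_cons, Matrix.range_empty, Set.union_empty] at this
    exact (Submodule.eq_of_le_of_finrank_le hspanK (by omega)).ge
  · have hprop : ∃ k : F, k • U = V := by
      by_contra hno
      push Not at hno
      exact hli ((LinearIndependent.pair_iff' hU).mpr hno)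
    by_cases h6 : A.card = 6
    · right
      obtain ⟨k, hk⟩ := hprop
      exact ⟨h6, k, fun a ha => (congrFun hk ⟨a, ha⟩).symm⟩
    · left
      have h1 : Module.finrank F (Submodule.span F {U}) = 1 := finrank_span_singleton hU
      have hle : Submodule.span F {U} ≤ Submodule.span F {U, V} :=
        Submodule.span_mono (by simp)
      refine le_trans (Submodule.eq_of_le_of_finrank_le (hle.trans hspanK) (by omega)).ge hle

end Rigidity

/-! ### The derivation `t d/dt` on Puiseux series -/

/-- The map `∑ c_q t^q ↦ ∑ q c_q t^q` on Hahn series. -/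
noncomputable def eulerFun (x : HahnSeries ℚ ℂ) : HahnSeries ℚ ℂ where
  coeff q := q * x.coeff q
  isPWO_support' := x.isPWO_support.mono fun q hq h => hq (by simp [h])

theorem coeff_eulerFun (x : HahnSeries ℚ ℂ) (q : ℚ) : (eulerFun x).coeff q = q * x.coeff q := rfl

theorem support_eulerFun_subset (x : HahnSeries ℚ ℂ) : (eulerFun x).support ⊆ x.support :=
  fun q hq h => by simp [coeff_eulerFun, h] at hq

theorem eulerFun_mul (x y : HahnSeries ℚ ℂ) :
    eulerFun (x * y) = x * eulerFun y + y * eulerFun x := by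
  ext q
  rw [coeff_eulerFun, mul_comm y, HahnSeries.coeff_add, HahnSeries.coeff_mul,
    HahnSeries.coeff_mul_right' y.isPWO_support (support_eulerFun_subset y),
    HahnSeries.coeff_mul_left' x.isPWO_support (support_eulerFun_subset x),
    ← Finset.sum_add_distrib, Finset.mul_sum]
  refine Finset.sum_congr rfl fun ij hij => ?_
  have h : ij.1 + ij.2 = q := (Finset.mem_antidiagonal.mp hij).2.2
  rw [coeff_eulerFun, coeff_eulerFun, ← h]
  push_cast
  ring

/-- The derivation `t d/dt` of the field of Puiseux series. -/
noncomputable def eulerDerivation : PuiseuxSeries →+ PuiseuxSeries where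
  toFun x := ⟨eulerFun x, by
    obtain ⟨m, hm⟩ := (mem_puiseuxSubfield _).mp x.2
    exact (mem_puiseuxSubfield _).mpr ⟨m, fun q hq => hm q (support_eulerFun_subset _ hq)⟩⟩
  map_zero' := by ext; simp [coeff_eulerFun]
  map_add' x y := by ext; simp [coeff_eulerFun, mul_add]

theorem coeff_eulerDerivation (x : PuiseuxSeries) (q : ℚ) :
    (eulerDerivation x : HahnSeries ℚ ℂ).coeff q = q * (x : HahnSeries ℚ ℂ).coeff q := rfl

theorem eulerDerivation_mul (x y : PuiseuxSeries) :
    eulerDerivation (x * y) = x * eulerDerivation y + y * eulerDerivation x :=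
  Subtype.ext (eulerFun_mul x y)

theorem puiseuxVal_mul {x y : PuiseuxSeries} (hx : x ≠ 0) (hy : y ≠ 0) :
    puiseuxVal (x * y) = puiseuxVal x + puiseuxVal y :=
  HahnSeries.order_mul (by simpa using hx) (by simpa using hy)

/-- Puiseux series with the same logarithmic derivative have a constant quotient, hence the same
valuation. -/
theorem puiseuxVal_eq_of_eulerDerivation_eq {x y c : PuiseuxSeries} (hx : x ≠ 0) (hy : y ≠ 0)
    (hDx : eulerDerivation x = c * x) (hDy : eulerDerivation y = c * y) :
    puiseuxVal x = puiseuxVal y := by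
  have hz : eulerDerivation (x / y) = 0 := leibniz_div_eq_zero _ eulerDerivation_mul hDx hDy
  have hz0 : x / y ≠ 0 := div_ne_zero hx hy
  have hval : puiseuxVal (x / y) = 0 := by
    have h1 := coeff_eulerDerivation (x / y) (puiseuxVal (x / y))
    rw [hz, ZeroMemClass.coe_zero, HahnSeries.coeff_zero] at h1
    have h2 : ((x / y : PuiseuxSeries) : HahnSeries ℚ ℂ).coeff (puiseuxVal (x / y)) ≠ 0 := by
      rw [puiseuxVal, ← HahnSeries.leadingCoeff_eq, HahnSeries.leadingCoeff_ne_zero]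
      simpa using hz0
    exact_mod_cast (mul_eq_zero_iff_right h2).mp h1.symm
  rw [← div_mul_cancel₀ x hy, puiseuxVal_mul hz0 hy, hval, zero_add]

/-! ### Six lattice points in four parity classes -/

section Parity

variable {F : Type*} [Field F]

/-- The pairing of a vector of `F³` with `ℤ³`. -/
def latticePairing (n : Fin 3 → F) : (Fin 3 → ℤ) →+ F where
  toFun a := ∑ i, n i * (a i : F)
  map_zero' := by simp
  map_add' a b := by simp [mul_add, Finset.sum_add_distrib]

theorem latticePairing_apply (n : Fin 3 → F) (a : Fin 3 → ℤ) :
    latticePairing n a = ∑ i, n i * (a i : F) := rfl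

theorem exists_latticePairing_eq_zero (x y : Fin 3 → ℤ) :
    ∃ n : Fin 3 → F, n ≠ 0 ∧ latticePairing n x = 0 ∧ latticePairing n y = 0 := by
  have hdet : (Matrix.of ![fun i => (x i : F), fun i => (y i : F), fun i => (y i : F)]).det = 0 :=
    Matrix.det_zero_of_row_eq (i := 1) (j := 2) (by decide) rfl
  obtain ⟨n, hn, h⟩ := Matrix.exists_mulVec_eq_zero_iff.mpr hdet
  refine ⟨n, hn, ?_, ?_⟩
  · simpa [Matrix.mulVec, dotProduct, latticePairing_apply, mul_comm] using congrFun h 0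
  · simpa [Matrix.mulVec, dotProduct, latticePairing_apply, mul_comm] using congrFun h 1

variable {A : Finset (Fin 3 → ℤ)} {u : (Fin 3 → ℤ) → F}

theorem IsNodalWeight.sum_mul_pairing_sub (hu : IsNodalWeight A u) (n : Fin 3 → F) (c : F) :
    ∑ a ∈ A, u a * (latticePairing n a - c) = 0 := by
  have h : ∀ a ∈ A, u a * (latticePairing n a - c) =
      ∑ i, n i * (u a * (a i : F)) - u a * c := by
    intro a _
    rw [mul_sub, latticePairing_apply, Finset.mul_sum]
    exact congrArg (· - u a * c) (Finset.sum_congr rfl fun i _ => by ring)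
  rw [Finset.sum_congr rfl h, Finset.sum_sub_distrib, Finset.sum_comm, ← Finset.sum_mul,
    hu.sum_eq_zero]
  simp [← Finset.mul_sum, hu.sum_mul_eq_zero]

/-- Five of the six points of `A` are never coplanar: the sixth point would not occur in any affine
dependence. -/
theorem IsNodalWeight.eq_zero_of_pairing_const (hu : IsNodalWeight A u) (hA : AffinelySpans F A)
    (hcard : A.card = 6) {T : Finset (Fin 3 → ℤ)} (hTA : T ⊆ A) (hT : 5 ≤ T.card)
    {n : Fin 3 → F} {c : F} (hn : ∀ a ∈ T, latticePairing n a = c) : n = 0 := by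
  have h1 : (A \ T).card ≤ 1 := by
    rw [Finset.card_sdiff_of_subset hTA]
    omega
  obtain ⟨r, hr⟩ := Finset.card_le_one_iff_subset_singleton.mp h1
  refine hA n c fun a ha => ?_
  by_cases haT : a ∈ T
  · exact hn a haT
  obtain rfl : a = r := Finset.mem_singleton.mp (hr (Finset.mem_sdiff.mpr ⟨ha, haT⟩))
  have hsum := hu.sum_mul_pairing_sub n c
  rw [Finset.sum_eq_single_of_mem a ha] at hsum
  · exact sub_eq_zero.mp ((mul_eq_zero_iff_left (hu.ne_zero a ha)).mp hsum)
  · intro b hb hba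
    have hbT : b ∈ T := by
      by_contra hbT
      exact hba (Finset.mem_singleton.mp (hr (Finset.mem_sdiff.mpr ⟨hb, hbT⟩)))
    rw [hn b hbT, sub_self, mul_zero]

theorem IsNodalWeight.not_coplanar [CharZero F] (hu : IsNodalWeight A u) (hA : AffinelySpans F A)
    (hcard : A.card = 6) {l : List (Fin 3 → ℤ)} (hl : l.Nodup) (hlen : l.length = 5)
    (hlA : ∀ a ∈ l, a ∈ A) (o x y : Fin 3 → ℤ)
    (hplane : ∀ a ∈ l, ∃ i j : ℤ, (2 : ℤ) • (a - o) = i • x + j • y) : False := by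
  obtain ⟨n, hn, hx, hy⟩ := exists_latticePairing_eq_zero (F := F) x y
  refine hn (hu.eq_zero_of_pairing_const hA hcard (T := l.toFinset) (c := latticePairing n o)
    (fun a ha => hlA a (List.mem_toFinset.mp ha)) ?_ ?_)
  · rw [List.toFinset_card_of_nodup hl, hlen]
  · intro a ha
    obtain ⟨i, j, h⟩ := hplane a (List.mem_toFinset.mp ha)
    have h' := congrArg (latticePairing n) h
    rw [map_zsmul, map_add, map_zsmul, map_zsmul, hx, hy, smul_zero, smul_zero, add_zero,
      zsmul_eq_mul, map_sub] at h'
    have h2 : ((2 : ℤ) : F) ≠ 0 := by norm_num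
    exact sub_eq_zero.mp ((mul_eq_zero_iff_left h2).mp h')

/-- Three points whose midpoints all lie in `A` give five coplanar points. -/
theorem IsNodalWeight.false_of_three_midpoints [CharZero F] (hu : IsNodalWeight A u)
    (hA : AffinelySpans F A) (hcard : A.card = 6) {p q r x y z : Fin 3 → ℤ} (hp : p ∈ A)
    (hq : q ∈ A) (hr : r ∈ A) (hx : x ∈ A) (hy : y ∈ A) (hz : z ∈ A) (hpq : p ≠ q) (hqr : q ≠ r)
    (hpr : p ≠ r) (hxm : x + x = p + q) (hym : y + y = q + r) (hzm : z + z = p + r) : False := by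
  have key : ∀ l : List (Fin 3 → ℤ), l.Nodup → l.length = 5 → (∀ a ∈ l, a ∈ [p, q, r, x, y, z]) →
      False := by
    intro l hl hlen hmem
    refine hu.not_coplanar hA hcard hl hlen ?_ p (q - p) (r - p) ?_
    · intro a ha
      have := hmem a ha
      simp only [List.mem_cons, List.not_mem_nil, or_false] at this
      rcases this with rfl | rfl | rfl | rfl | rfl | rfl <;> assumption
    · intro a ha
      have := hmem a ha
      simp only [List.mem_cons, List.not_mem_nil, or_false] at this
      rcases this with rfl | rfl | rfl | rfl | rfl | rfl
      · exact ⟨0, 0, by module⟩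
      · exact ⟨2, 0, by module⟩
      · exact ⟨0, 2, by module⟩
      · exact ⟨1, 0, by grind⟩
      · exact ⟨1, 1, by grind⟩
      · exact ⟨0, 1, by grind⟩
  by_cases hxr : x = r
  · exact key [p, q, r, y, z] (by simp; grind) rfl (by simp)
  · by_cases hyp : y = p
    · exact key [p, q, r, x, z] (by simp; grind) rfl (by simp)
    · exact key [p, q, r, x, y] (by simp; grind) rfl (by simp)

/-- If an endpoint of a segment is the midpoint of another one, then there are five coplanar
points. -/
theorem IsNodalWeight.false_of_midpoint_eq_endpoint [CharZero F] (hu : IsNodalWeight A u)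
    (hA : AffinelySpans F A) (hcard : A.card = 6) {p p' q q' m : Fin 3 → ℤ} (hp : p ∈ A)
    (hp' : p' ∈ A) (hq : q ∈ A) (hq' : q' ∈ A) (hm : m ∈ A) (hpp : p ≠ p') (hqq : q ≠ q')
    (hpq' : p ≠ q') (hpq'' : p' ≠ q') (hqm : q + q = p + p') (hmm : m + m = q + q') : False := by
  by_cases hmp : m = p ∨ m = p'
  · have hlt : ({p, p', q, q'} : Finset (Fin 3 → ℤ)).card < A.card := by
      have := Finset.card_le_four (a := p) (b := p') (c := q) (d := q')
      omega
    obtain ⟨r, hr, hrn⟩ := Finset.exists_mem_notMem_of_card_lt_card hlt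
    refine hu.not_coplanar hA hcard (l := [p, p', q, q', r]) (by simp at hrn ⊢; grind) rfl
      (by simp [*]) q (p' - p) (r - q) ?_
    simp only [List.forall_mem_cons, List.not_mem_nil, false_implies, implies_true, and_true]
    refine ⟨⟨-1, 0, by grind⟩, ⟨1, 0, by grind⟩, ⟨0, 0, by grind⟩, ?_, ⟨0, 2, by grind⟩⟩
    rcases hmp with rfl | rfl
    · exact ⟨-2, 0, by grind⟩
    · exact ⟨2, 0, by grind⟩
  · push Not at hmp
    refine hu.not_coplanar hA hcard (l := [p, p', q, q', m]) (by simp; grind) rfl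
      (by simp [*]) q (p' - p) (q' - q) ?_
    simp only [List.forall_mem_cons, List.not_mem_nil, false_implies, implies_true, and_true]
    exact ⟨⟨-1, 0, by grind⟩, ⟨1, 0, by grind⟩, ⟨0, 0, by grind⟩, ⟨0, 2, by grind⟩,
      ⟨0, 1, by grind⟩⟩

/-- If `A` consists of two segments with their midpoints, the quadratic form of a dependence has
rank at most two: it degenerates along the common normal of the segments. -/
theorem IsNodalWeight.false_of_two_segments [CharZero F] (hu : IsNodalWeight A u)
    (hA : AffinelySpans F A) (hcard : A.card = 6) {p m p' q l q' : Fin 3 → ℤ}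
    (hnodup : [p, m, p', q, l, q'].Nodup) (hmem : ∀ a ∈ [p, m, p', q, l, q'], a ∈ A)
    (hm : m + m = p + p') (hl : l + l = q + q') : False := by
  have hAeq : [p, m, p', q, l, q'].toFinset = A := by
    refine Finset.eq_of_subset_of_card_le (fun a ha => hmem a (List.mem_toFinset.mp ha)) ?_
    rw [List.toFinset_card_of_nodup hnodup, hcard]
    rfl
  have hsum : ∀ g : (Fin 3 → ℤ) → F, ∑ a ∈ A, g a = g p + g m + g p' + (g q + g l + g q') := by
    intro g
    rw [← hAeq, List.sum_toFinset g hnodup]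
    simp only [List.map_cons, List.map_nil, List.sum_cons, List.sum_nil]
    ring
  have hforall : ∀ P : (Fin 3 → ℤ) → Prop, P p → P m → P p' → P q → P l → P q' →
      ∀ a ∈ A, P a := by
    intro P h1 h2 h3 h4 h5 h6 a ha
    rw [← hAeq] at ha
    simp only [List.mem_toFinset, List.mem_cons, List.not_mem_nil, or_false] at ha
    rcases ha with rfl | rfl | rfl | rfl | rfl | rfl <;> assumption
  have h2 : (2 : F) ≠ 0 := two_ne_zero
  have hends : ∀ (n : Fin 3 → F) {x y z : Fin 3 → ℤ}, y + y = x + z →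
      latticePairing n (y - x) = 0 →
      latticePairing n x = latticePairing n y ∧ latticePairing n z = latticePairing n y := by
    intro n x y z h h0
    have h' := congrArg (latticePairing n) h
    rw [map_add, map_add] at h'
    rw [map_sub] at h0
    exact ⟨by linear_combination -h0, by linear_combination h0 - h'⟩
  have hcoord : ∀ {x y z : Fin 3 → ℤ}, y + y = x + z → ∀ j, (x j : F) = 2 * y j - z j := by
    intro x y z h j
    have := congrArg (fun k : ℤ => (k : F)) (congrFun h j)
    simp only [Pi.add_apply, Int.cast_add] at this
    linear_combination -this
  obtain ⟨n, hn0, hnp, hnq⟩ := exists_latticePairing_eq_zero (F := F) (m - p) (l - q)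
  obtain ⟨hp1, hp2⟩ := hends n hm hnp
  obtain ⟨hq1, hq2⟩ := hends n hl hnq
  by_cases hc : latticePairing n m = latticePairing n l
  · refine hn0 (hA n (latticePairing n l) ?_)
    exact hforall (fun a => latticePairing n a = latticePairing n l)
      (hp1.trans hc) hc (hp2.trans hc) hq1 rfl hq2
  have hc' : latticePairing n m - latticePairing n l ≠ 0 := sub_ne_zero.mpr hc
  have hsp : u p + u m + u p' = 0 := by
    have h := hu.sum_mul_pairing_sub n (latticePairing n l)
    rw [hsum, hp1, hp2, hq1, hq2] at h
    refine (mul_eq_zero_iff_right hc').mp ?_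
    linear_combination h
  have hsq : u q + u l + u q' = 0 := by
    have h := hu.sum_eq_zero
    rw [hsum] at h
    linear_combination h - hsp
  -- the first moments give a linear relation between the directions of the two segments
  have hmom : ∀ j, (u p' - u p) * ((p' j : F) - m j) + (u q' - u q) * ((q' j : F) - l j) = 0 := by
    intro j
    have h := hu.sum_mul_eq_zero j
    rw [hsum, hcoord hm j, hcoord hl j] at h
    linear_combination h - (m j : F) * hsp - (l j : F) * hsq
  by_cases hsym : u p' = u p
  · refine hn0 (hu.nondegenerate n fun j => ?_)
    have hqj : (u q' - u q) * ((q' j : F) - l j) = 0 := by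
      have := hmom j
      rwa [hsym, sub_self, zero_mul, zero_add] at this
    simp only [← latticePairing_apply]
    rw [hsum, hp1, hp2, hq1, hq2, hcoord hm j, hcoord hl j, hsym]
    linear_combination latticePairing n l * hqj + latticePairing n l * (l j : F) * hsq +
      latticePairing n m * (m j : F) * (hsp - hsym)
  · obtain ⟨k, hk0, hkq, hkm⟩ := exists_latticePairing_eq_zero (F := F) (l - q) (l - m)
    obtain ⟨hq1, hq2⟩ := hends k hl hkq
    have hkm' : latticePairing k m = latticePairing k l := by
      rw [map_sub] at hkm
      exact (sub_eq_zero.mp hkm).symm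
    have hkp : latticePairing k p' = latticePairing k m := by
      have h : (u p' - u p) * (latticePairing k p' - latticePairing k m) +
          (u q' - u q) * (latticePairing k q' - latticePairing k l) = 0 := by
        simp only [latticePairing_apply, ← Finset.sum_sub_distrib, Finset.mul_sum,
          ← Finset.sum_add_distrib]
        exact Finset.sum_eq_zero fun j _ => by linear_combination k j * hmom j
      rw [hq2, sub_self, mul_zero, add_zero] at h
      exact sub_eq_zero.mp ((mul_eq_zero_iff_left (sub_ne_zero.mpr hsym)).mp h)
    have hkp' : latticePairing k p = latticePairing k m := by
      have h' := congrArg (latticePairing k) hm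
      rw [map_add, map_add] at h'
      linear_combination -h' - hkp
    refine hk0 (hA k (latticePairing k l) ?_)
    exact hforall (fun a => latticePairing k a = latticePairing k l)
      (hkp'.trans hkm') hkm' (hkp.trans hkm') hq1 rfl hq2

theorem zpow_eq_one_of_even {s : Fˣ} (hs : s ^ 2 = 1) {k : ℤ} (hk : Even k) : s ^ k = 1 := by
  obtain ⟨j, rfl⟩ := hk
  rw [← two_mul, zpow_mul]
  have : s ^ (2 : ℤ) = 1 := by exact_mod_cast hs
  rw [this, one_zpow]

/-- A character of order two of `ℤ³` that is nontrivial in the coordinate `i₀` determines the parity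
of this coordinate from those of the other two. -/
theorem even_sub_of_prod_zpow_eq {s : Fin 3 → Fˣ} (hs : ∀ i, s i ^ 2 = 1) {i₀ : Fin 3}
    (hi₀ : s i₀ ≠ 1) {a b : Fin 3 → ℤ} (hab : ∏ i, s i ^ a i = ∏ i, s i ^ b i)
    (h : ∀ i, i ≠ i₀ → Even (a i - b i)) (i : Fin 3) : Even (a i - b i) := by
  by_cases hi : i = i₀
  · subst hi
    have hprod : ∏ j, s j ^ (a j - b j) = 1 := by
      simp only [zpow_sub, Finset.prod_mul_distrib, Finset.prod_inv_distrib, hab]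
      exact mul_inv_cancel _
    rw [Finset.prod_eq_single i (fun j _ hj => zpow_eq_one_of_even (hs j) (h j hj))
      (by simp)] at hprod
    by_contra hodd
    rw [Int.not_even_iff_odd] at hodd
    obtain ⟨k, hk⟩ := hodd
    rw [hk, zpow_add, zpow_one, zpow_eq_one_of_even (hs i) (even_two_mul k), one_mul] at hprod
    exact hi₀ hprod
  · exact h i hi

/-- Among five lattice points on which such a character is constant, two are congruent
modulo two. -/
theorem exists_ne_even_sub {s : Fin 3 → Fˣ} (hs : ∀ i, s i ^ 2 = 1) {i₀ : Fin 3}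
    (hi₀ : s i₀ ≠ 1) {B : Finset (Fin 3 → ℤ)} (hB : 5 ≤ B.card)
    (hconst : ∀ a ∈ B, ∀ b ∈ B, ∏ i, s i ^ a i = ∏ i, s i ^ b i) :
    ∃ a ∈ B, ∃ b ∈ B, a ≠ b ∧ ∀ i, Even (a i - b i) := by
  have hcard : (Finset.univ : Finset ({i // i ≠ i₀} → ZMod 2)).card < B.card := by
    have h2 : Fintype.card {i // i ≠ i₀} = 2 := by
      revert i₀
      intro i₀ _
      fin_cases i₀ <;> rfl
    rw [Finset.card_univ, Fintype.card_fun, h2, ZMod.card]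
    omega
  obtain ⟨a, ha, b, hb, hne, heq⟩ := Finset.exists_ne_map_eq_of_card_lt_of_maps_to hcard
    (f := fun a i => (a i.1 : ZMod 2)) (fun _ _ => Finset.mem_univ _)
  refine ⟨a, ha, b, hb, hne, even_sub_of_prod_zpow_eq hs hi₀ (hconst a ha b hb) fun i hi => ?_⟩
  rw [← neg_sub, even_neg, even_iff_two_dvd]
  exact (ZMod.intCast_eq_intCast_iff_dvd_sub _ _ 2).mp (congrFun heq ⟨i, hi⟩)

/-- A six-point set carrying a nodal weight and closed under taking lattice midpoints is not
contained in a level set of a character of order two. -/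
theorem IsNodalWeight.false_of_character_const [CharZero F] (hu : IsNodalWeight A u)
    (hA : AffinelySpans F A) (hcard : A.card = 6)
    (hmid : ∀ a ∈ A, ∀ b ∈ A, ∀ m : Fin 3 → ℤ, m + m = a + b → m ∈ A)
    {s : Fin 3 → Fˣ} (hs : ∀ i, s i ^ 2 = 1) (hs1 : s ≠ 1)
    (hconst : ∀ a ∈ A, ∀ b ∈ A, ∏ i, s i ^ a i = ∏ i, s i ^ b i) : False := by
  obtain ⟨i₀, hi₀⟩ := Function.ne_iff.mp hs1
  have hmid' : ∀ a ∈ A, ∀ b ∈ A, (∀ i, Even (a i - b i)) → ∃ m ∈ A, m + m = a + b := by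
    intro a ha b hb h
    have h' : ∀ i, ∃ k, a i + b i = k + k := fun i => by
      obtain ⟨k, hk⟩ := h i
      exact ⟨k + b i, by omega⟩
    choose m hm using h'
    exact ⟨m, hmid a ha b hb m (funext fun i => (hm i).symm), funext fun i => (hm i).symm⟩
  obtain ⟨p, hp, p', hp', hpp, hpe⟩ := exists_ne_even_sub hs hi₀ (by omega) hconst
  have hcard' : 5 ≤ (A.erase p).card := by
    rw [Finset.card_erase_of_mem hp]
    omega
  obtain ⟨q, hqA, q', hqA', hqq, hqe⟩ := exists_ne_even_sub hs hi₀ hcard' fun a ha b hb =>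
    hconst a (Finset.mem_of_mem_erase ha) b (Finset.mem_of_mem_erase hb)
  obtain ⟨hqp, hq⟩ := Finset.mem_erase.mp hqA
  obtain ⟨hqp', hq'⟩ := Finset.mem_erase.mp hqA'
  obtain ⟨m, hm, hmm⟩ := hmid' p hp p' hp' hpe
  obtain ⟨l, hl, hll⟩ := hmid' q hq q' hq' hqe
  -- no three points of `A` are congruent modulo two
  have hthree : ∀ a ∈ A, ∀ b ∈ A, ∀ c ∈ A, a ≠ b → b ≠ c → a ≠ c → (∀ i, Even (a i - b i)) →
      (∀ i, Even (b i - c i)) → False := by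
    intro a ha b hb c hc hab hbc hac h1 h2
    have h3 : ∀ i, Even (a i - c i) := fun i => by
      have := (h1 i).add (h2 i)
      rwa [sub_add_sub_cancel] at this
    obtain ⟨x, hx, hxm⟩ := hmid' a ha b hb h1
    obtain ⟨y, hy, hym⟩ := hmid' b hb c hc h2
    obtain ⟨z, hz, hzm⟩ := hmid' a ha c hc h3
    exact hu.false_of_three_midpoints hA hcard ha hb hc hx hy hz hab hbc hac hxm hym hzm
  have hp'q : p' ≠ q := by
    rintro rfl
    exact hthree p hp p' hp' q' hq' hpp hqq hqp'.symm hpe hqe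
  have hp'q' : p' ≠ q' := by
    rintro rfl
    exact hthree p hp p' hp' q hq hpp hp'q hqp.symm hpe fun i => by
      have := (hqe i).neg
      rwa [neg_sub] at this
  by_cases hml : m = l
  · subst hml
    refine hu.not_coplanar hA hcard (l := [p, p', q, q', m]) (by simp; grind) rfl
      (by simp [*]) m (p' - p) (q' - q) ?_
    simp only [List.forall_mem_cons, List.not_mem_nil, false_implies, implies_true, and_true]
    exact ⟨⟨-1, 0, by grind⟩, ⟨1, 0, by grind⟩, ⟨0, -1, by grind⟩, ⟨0, 1, by grind⟩,
      ⟨0, 0, by grind⟩⟩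
  by_cases h1 : m = q
  · subst h1
    exact hu.false_of_midpoint_eq_endpoint hA hcard hp hp' hq hq' hl hpp hqq hqp'.symm hp'q' hmm hll
  by_cases h2 : m = q'
  · subst h2
    exact hu.false_of_midpoint_eq_endpoint hA hcard hp hp' hq' hq hl hpp hqq.symm hqp.symm hp'q hmm
      (hll.trans (add_comm _ _))
  by_cases h3 : l = p
  · subst h3
    exact hu.false_of_midpoint_eq_endpoint hA hcard hq hq' hp hp' hm hqq hpp hp'q.symm hp'q'.symm
      hll hmm
  by_cases h4 : l = p'
  · subst h4
    exact hu.false_of_midpoint_eq_endpoint hA hcard hq hq' hp' hp hm hqq hpp.symm hqp hqp'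
      hll (hmm.trans (add_comm _ _))
  · exact hu.false_of_two_segments hA hcard (p := p) (m := m) (p' := p') (q := q) (l := l)
      (q' := q') (by simp; grind) (by simp [*]) hmm hll

end Parity

/-! ### Tropical hypersurfaces with a common apex -/

section Fan

variable {f : LaurentPoly PuiseuxSeries} {v : Fin 3 → ℝ} {M : ℝ}

theorem mem_maxTerms {w : Fin 3 → ℝ} {a : Fin 3 → ℤ} :
    a ∈ maxTerms f w ↔
      a ∈ f.coeff.support ∧ ∀ b ∈ f.coeff.support, tropTerm f w b ≤ tropTerm f w a := by
  simp [maxTerms]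

theorem maxTerms_nonempty (hne : f.coeff.support.Nonempty) (w : Fin 3 → ℝ) :
    (maxTerms f w).Nonempty := by
  obtain ⟨a, ha, hmax⟩ := f.coeff.support.exists_max_image (tropTerm f w) hne
  exact ⟨a, mem_maxTerms.mpr ⟨ha, hmax⟩⟩

theorem mem_tropicalCell {w x : Fin 3 → ℝ} :
    x ∈ tropicalCell f w ↔ maxTerms f w ⊆ maxTerms f x := Iff.rfl

theorem tropTerm_eq_dotProduct (w : Fin 3 → ℝ) (a : Fin 3 → ℤ) :
    tropTerm f w a = tropTerm f 0 a + latticePoint a ⬝ᵥ w := by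
  simp [tropTerm, dotProduct, latticePoint]

/-- A cell is cut out by the inequalities saying that the terms maximal at `w` dominate. -/
theorem mem_tropicalCell_iff {w x : Fin 3 → ℝ} :
    x ∈ tropicalCell f w ↔
      ∀ a ∈ maxTerms f w, ∀ b ∈ f.coeff.support, tropTerm f x b ≤ tropTerm f x a :=
  ⟨fun h _ ha => (mem_maxTerms.mp (h ha)).2,
    fun h a ha => mem_maxTerms.mpr ⟨(mem_maxTerms.mp ha).1, h a ha⟩⟩

theorem tropTerm_add_smul (x y : Fin 3 → ℝ) {s t : ℝ} (hst : s + t = 1) (a : Fin 3 → ℤ) :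
    tropTerm f (s • x + t • y) a = s * tropTerm f x a + t * tropTerm f y a := by
  rw [tropTerm_eq_dotProduct, tropTerm_eq_dotProduct x, tropTerm_eq_dotProduct y, dotProduct_add,
    dotProduct_smul, dotProduct_smul, smul_eq_mul, smul_eq_mul]
  linear_combination -(tropTerm f 0 a) * hst

theorem convex_tropicalCell (w : Fin 3 → ℝ) : Convex ℝ (tropicalCell f w) := by
  intro x hx y hy s t hs ht hst
  rw [mem_tropicalCell_iff] at hx hy ⊢
  intro a ha b hb
  rw [tropTerm_add_smul x y hst, tropTerm_add_smul x y hst]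
  exact add_le_add (mul_le_mul_of_nonneg_left (hx a ha b hb) hs)
    (mul_le_mul_of_nonneg_left (hy a ha b hb) ht)

/-- If some term is maximal at both `x` and `y`, then only such terms are maximal at the
midpoint. -/
theorem maxTerms_midpoint_subset {x y : Fin 3 → ℝ} {a₀ : Fin 3 → ℤ} (hx : a₀ ∈ maxTerms f x)
    (hy : a₀ ∈ maxTerms f y) :
    maxTerms f ((1 / 2 : ℝ) • x + (1 / 2 : ℝ) • y) ⊆ maxTerms f x ∩ maxTerms f y := by
  intro a ha
  rw [mem_maxTerms] at hx hy ha
  have h := ha.2 a₀ hx.1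
  rw [tropTerm_add_smul x y (by norm_num), tropTerm_add_smul x y (by norm_num)] at h
  have h1 := hx.2 a ha.1
  have h2 := hy.2 a ha.1
  rw [Finset.mem_inter, mem_maxTerms, mem_maxTerms]
  exact ⟨⟨ha.1, fun b hb => (hx.2 b hb).trans (by linarith)⟩,
    ⟨ha.1, fun b hb => (hy.2 b hb).trans (by linarith)⟩⟩

/-- A segment from a point `x` of the cell of `y` to `y` can be prolonged beyond `y` inside every
cell containing `y`. -/
theorem exists_extend_mem_tropicalCell {w x y : Fin 3 → ℝ} (hy : y ∈ tropicalCell f w)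
    (hx : x ∈ tropicalCell f y) :
    ∃ δ : ℝ, 0 < δ ∧ (-δ) • x + (1 + δ) • y ∈ tropicalCell f w := by
  have hev : ∀ᶠ δ : ℝ in nhdsWithin 0 (Set.Ioi 0), ∀ a ∈ maxTerms f w, ∀ b ∈ f.coeff.support,
      tropTerm f ((-δ) • x + (1 + δ) • y) b ≤ tropTerm f ((-δ) • x + (1 + δ) • y) a := by
    refine (Filter.eventually_all_finset _).mpr fun a ha =>
      (Filter.eventually_all_finset _).mpr fun b hb => ?_
    have hval : ∀ δ : ℝ, ∀ c, tropTerm f ((-δ) • x + (1 + δ) • y) c =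
        -δ * tropTerm f x c + (1 + δ) * tropTerm f y c :=
      fun δ c => tropTerm_add_smul x y (by ring) c
    simp only [hval]
    have hay := mem_maxTerms.mp (hy ha)
    have hax := mem_maxTerms.mp (hx (hy ha))
    by_cases hby : b ∈ maxTerms f y
    · have hy' : tropTerm f y b = tropTerm f y a :=
        le_antisymm (hay.2 b hb) ((mem_maxTerms.mp hby).2 a hay.1)
      have hx' : tropTerm f x b = tropTerm f x a :=
        le_antisymm (hax.2 b hb) ((mem_maxTerms.mp (hx hby)).2 a hay.1)
      rw [hy', hx']
      exact Filter.Eventually.of_forall fun _ => le_rfl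
    · have hlt : tropTerm f y b < tropTerm f y a := by
        by_contra hle
        exact hby (mem_maxTerms.mpr ⟨hb, fun c hc => (hay.2 c hc).trans (not_lt.mp hle)⟩)
      have hcont : ∀ c, Filter.Tendsto
          (fun δ : ℝ => -δ * tropTerm f x c + (1 + δ) * tropTerm f y c) (nhds 0)
          (nhds (tropTerm f y c)) := fun c =>
        Continuous.tendsto' (by fun_prop) _ _ (by simp)
      exact (((hcont b).eventually_lt (hcont a) hlt).mono fun _ h => h.le).filter_mono
        nhdsWithin_le_nhds
  obtain ⟨δ, hδ, hpos⟩ := (hev.and self_mem_nhdsWithin).exists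
  exact ⟨δ, hpos, mem_tropicalCell_iff.mpr hδ⟩

/-- Nonempty exposed faces of cells are cells: the face is the cell of any of its points at
which the fewest terms are maximal. -/
theorem isExposed_tropicalCell_mem (hne : f.coeff.support.Nonempty) {σ τ : Set (Fin 3 → ℝ)}
    (hσ : σ ∈ tropicalComplex f) (hτ : τ.Nonempty) (hexp : IsExposed ℝ σ τ) :
    τ ∈ tropicalComplex f := by
  obtain ⟨w, hw, rfl⟩ := hσ
  have hconv : Convex ℝ τ := hexp.convex (convex_tropicalCell w)
  obtain ⟨l, hl⟩ := hexp hτ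
  have hτσ : ∀ x ∈ τ, x ∈ tropicalCell f w := fun x hx => by
    rw [hl] at hx
    exact hx.1
  obtain ⟨y, hy, hmin⟩ :=
    (InvImage.wf (fun y => (maxTerms f y).card) wellFounded_lt).has_min τ hτ
  obtain ⟨a₀, ha₀⟩ := maxTerms_nonempty hne w
  refine ⟨y, le_trans hw (Finset.card_le_card (hτσ y hy)), Set.Subset.antisymm ?_ ?_⟩
  · intro x hx
    have hxσ : x ∈ tropicalCell f w := fun a ha => hx (hτσ y hy ha)
    obtain ⟨δ, hδ, hmem⟩ := exists_extend_mem_tropicalCell (hτσ y hy) hx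
    have hy' := hy
    rw [hl] at hy' ⊢
    refine ⟨hxσ, fun z hz => (hy'.2 z hz).trans ?_⟩
    have h := hy'.2 _ hmem
    rw [map_add, map_smul, map_smul, smul_eq_mul, smul_eq_mul] at h
    have h' : δ * l y ≤ δ * l x := by linarith
    exact le_of_mul_le_mul_left h' hδ
  · intro x hx
    have hsub := maxTerms_midpoint_subset (hτσ x hx ha₀) (hτσ y hy ha₀)
    have hmid : (1 / 2 : ℝ) • x + (1 / 2 : ℝ) • y ∈ τ :=
      hconv hx hy (by norm_num) (by norm_num) (by norm_num)
    have heq := Finset.eq_of_subset_of_card_le (hsub.trans Finset.inter_subset_right)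
      (not_lt.mp (hmin _ hmid))
    rw [mem_tropicalCell, ← heq]
    exact hsub.trans Finset.inter_subset_left

theorem tropTerm_eq_of_apex (hM : ∀ a ∈ f.coeff.support, tropTerm f v a = M) (w : Fin 3 → ℝ)
    {a : Fin 3 → ℤ} (ha : a ∈ f.coeff.support) :
    tropTerm f w a = M + latticePoint a ⬝ᵥ (w - v) := by
  have h := hM a ha
  rw [tropTerm_eq_dotProduct] at h ⊢
  rw [dotProduct_sub]
  linarith

theorem maxTerms_apex (hM : ∀ a ∈ f.coeff.support, tropTerm f v a = M) :
    maxTerms f v = f.coeff.support := by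
  ext a
  rw [mem_maxTerms, and_iff_left_iff_imp]
  exact fun ha b hb => by rw [hM a ha, hM b hb]

theorem apex_mem_tropicalCell (hM : ∀ a ∈ f.coeff.support, tropTerm f v a = M)
    (w : Fin 3 → ℝ) : v ∈ tropicalCell f w := by
  rw [mem_tropicalCell, maxTerms_apex hM]
  exact fun a ha => (mem_maxTerms.mp ha).1

theorem mem_tropicalCell_iff_of_apex (hM : ∀ a ∈ f.coeff.support, tropTerm f v a = M)
    {w x : Fin 3 → ℝ} :
    x ∈ tropicalCell f w ↔ ∀ a ∈ maxTerms f w, ∀ b ∈ f.coeff.support,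
      (latticePoint b - latticePoint a) ⬝ᵥ (x - v) ≤ 0 := by
  rw [mem_tropicalCell_iff]
  refine forall₂_congr fun a ha => forall₂_congr fun b hb => ?_
  rw [tropTerm_eq_of_apex hM x hb, tropTerm_eq_of_apex hM x (mem_maxTerms.mp ha).1,
    add_le_add_iff_left, sub_dotProduct, sub_nonpos]

/-- The intersection of two cells is the face of the first one on which the terms maximal at `w'`
agree with a term `a₀` maximal at `w`; it is exposed by the sum of the differences. -/
theorem isExposed_inter_tropicalCell (hne : f.coeff.support.Nonempty)
    (hM : ∀ a ∈ f.coeff.support, tropTerm f v a = M) (w w' : Fin 3 → ℝ) :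
    IsExposed ℝ (tropicalCell f w) (tropicalCell f w ∩ tropicalCell f w') := by
  intro _
  obtain ⟨a₀, ha₀⟩ := maxTerms_nonempty hne w
  let l : StrongDual ℝ (Fin 3 → ℝ) :=
    ∑ b ∈ maxTerms f w', ∑ i, (latticePoint b i - latticePoint a₀ i) • ContinuousLinearMap.proj i
  have hl : ∀ x, l x = l v + ∑ b ∈ maxTerms f w',
      (latticePoint b - latticePoint a₀) ⬝ᵥ (x - v) := by
    intro x
    have h : ∀ z, l z = ∑ b ∈ maxTerms f w', (latticePoint b - latticePoint a₀) ⬝ᵥ z := fun z => by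
      simp [l, dotProduct]
    rw [h x, h v, ← Finset.sum_add_distrib]
    exact Finset.sum_congr rfl fun b _ => by rw [← dotProduct_add, add_sub_cancel]
  have hnonpos : ∀ x ∈ tropicalCell f w, ∀ b ∈ maxTerms f w',
      (latticePoint b - latticePoint a₀) ⬝ᵥ (x - v) ≤ 0 := fun x hx b hb =>
    (mem_tropicalCell_iff_of_apex hM).mp hx a₀ ha₀ b (mem_maxTerms.mp hb).1
  refine ⟨l, Set.ext fun x => and_congr_right fun hx => ⟨fun hx' y hy => ?_, fun hmax => ?_⟩⟩
  · rw [hl y, hl x]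
    refine add_le_add le_rfl ((Finset.sum_nonpos (hnonpos y hy)).trans ?_)
    refine Finset.sum_nonneg fun b hb => ?_
    have h := (mem_tropicalCell_iff_of_apex hM).mp hx' b hb a₀ (mem_maxTerms.mp ha₀).1
    rw [← neg_sub, neg_dotProduct] at h
    linarith
  · have h := hmax v (apex_mem_tropicalCell hM w)
    rw [hl x] at h
    have hzero := (Finset.sum_eq_zero_iff_of_nonpos (hnonpos x hx)).mp
      (le_antisymm (Finset.sum_nonpos (hnonpos x hx)) (by linarith))
    refine (mem_tropicalCell_iff_of_apex hM).mpr fun b hb c hc => ?_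
    have h1 := (mem_tropicalCell_iff_of_apex hM).mp hx a₀ ha₀ c hc
    have h2 := hzero b hb
    rw [sub_dotProduct] at h1 h2 ⊢
    linarith

/-- The exponents affinely span, so all terms agree at no more than one point. -/
theorem eq_of_dotProduct_const {A : Finset (Fin 3 → ℤ)} (hA : AffinelySpans ℝ A)
    {x y : Fin 3 → ℝ} {c : ℝ} (h : ∀ a ∈ A, latticePoint a ⬝ᵥ (x - y) = c) : x = y := by
  refine sub_eq_zero.mp (hA (x - y) c fun a ha => ?_)
  rw [← h a ha, dotProduct_comm]
  rfl

/-- If all terms agree at `v`, and the exponents affinely span, then the tropical surface is a fan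
with vertex `v`. -/
theorem isFanWithVertex_of_tropTerm_eq (hA : AffinelySpans ℝ f.coeff.support)
    (hcard : 2 ≤ f.coeff.support.card)
    (hM : ∀ a ∈ f.coeff.support, tropTerm f v a = M) :
    IsFanWithVertex (tropicalComplex f) v := by
  classical
  have hne : f.coeff.support.Nonempty := Finset.card_pos.mp (by omega)
  refine ⟨?_, ?_, fun σ hσ τ hτ hexp => isExposed_tropicalCell_mem hne hσ hτ hexp, ?_, ?_⟩
  · refine ((f.coeff.support.powerset.finite_toSet).image
      fun B => {x | B ⊆ maxTerms f x}).subset ?_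
    rintro _ ⟨w, -, rfl⟩
    exact ⟨maxTerms f w,
      Finset.mem_coe.mpr (Finset.mem_powerset.mpr fun a ha => (mem_maxTerms.mp ha).1), rfl⟩
  · rintro _ ⟨w, -, rfl⟩
    refine ⟨(maxTerms f w ×ˢ f.coeff.support).image
      fun ab => latticePoint ab.2 - latticePoint ab.1, Set.ext fun x => ?_⟩
    rw [mem_tropicalCell_iff_of_apex hM, Set.mem_ofPred_eq, Finset.forall_mem_image]
    exact ⟨fun h ab hab => h ab.1 (Finset.mem_product.mp hab).1 ab.2 (Finset.mem_product.mp hab).2,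
      fun h a ha b hb => h (x := (a, b)) (Finset.mem_product.mpr ⟨ha, hb⟩)⟩
  · rintro _ ⟨w, -, rfl⟩ _ ⟨w', -, rfl⟩
    refine ⟨isExposed_inter_tropicalCell hne hM w w', ?_⟩
    rw [Set.inter_comm]
    exact isExposed_inter_tropicalCell hne hM w' w
  · refine ⟨v, ?_, Set.ext fun x => ?_⟩
    · rw [tropicalSurface, Set.mem_ofPred_eq, maxTerms_apex hM]
      exact hcard
    · rw [mem_tropicalCell_iff_of_apex hM, maxTerms_apex hM, Set.mem_singleton_iff]
      constructor
      · intro h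
        obtain ⟨a₀, ha₀⟩ := hne
        refine eq_of_dotProduct_const hA (c := latticePoint a₀ ⬝ᵥ (x - v)) fun a ha => ?_
        have h1 := h a ha a₀ ha₀
        have h2 := h a₀ ha₀ a ha
        rw [sub_dotProduct] at h1 h2
        linarith
      · rintro rfl a _ b _
        simp

end Fan

/-! ### Binodal surfaces with six lattice points -/

section Binodal

theorem IsNodalWeight.mul_const {F : Type*} [Field F] {A : Finset (Fin 3 → ℤ)}
    {u v : (Fin 3 → ℤ) → F} (hu : IsNodalWeight A u) {k : F} (hk : k ≠ 0)
    (hv : ∀ a ∈ A, v a = u a * k) : IsNodalWeight A v := by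
  refine ⟨fun a ha => ?_, ?_, fun i => ?_, fun n hn => hu.nondegenerate n fun j => ?_⟩
  · rw [hv a ha]
    exact mul_ne_zero (hu.ne_zero a ha) hk
  · rw [Finset.sum_congr rfl hv, ← Finset.sum_mul, hu.sum_eq_zero, zero_mul]
  · rw [← zero_mul k, ← hu.sum_mul_eq_zero i, Finset.sum_mul]
    exact Finset.sum_congr rfl fun a ha => by rw [hv a ha]; ring
  · refine (mul_eq_zero_iff_left hk).mp ?_
    rw [← hn j, Finset.mul_sum]
    exact Finset.sum_congr rfl fun a ha => by rw [hv a ha]; ring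

/-- The valuation as a homomorphism on the multiplicative group of the field. -/
noncomputable def puiseuxValHom : PuiseuxSeriesˣ →* Multiplicative ℚ where
  toFun x := Multiplicative.ofAdd (puiseuxVal x)
  map_one' := by simp [puiseuxVal]
  map_mul' x y := by
    rw [Units.val_mul, puiseuxVal_mul x.ne_zero y.ne_zero, ofAdd_add]

theorem puiseuxVal_prod_zpow (p : Fin 3 → PuiseuxSeriesˣ) (a : Fin 3 → ℤ) :
    puiseuxVal ((∏ i, p i ^ a i : PuiseuxSeriesˣ) : PuiseuxSeries) =
      ∑ i, a i * puiseuxVal (p i) := by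
  have h := congrArg Multiplicative.toAdd (map_prod puiseuxValHom (fun i => p i ^ a i) Finset.univ)
  simp only [map_zpow, Fin.prod_univ_three, toAdd_mul, toAdd_zpow] at h
  simp only [Fin.prod_univ_three, Fin.sum_univ_three]
  simpa [puiseuxValHom] using h

/-- At the tropicalization of `p`, the tropical terms are the negated valuations of the terms at
`p`. -/
theorem tropTerm_tropPoint (f : LaurentPoly PuiseuxSeries) (p : Fin 3 → PuiseuxSeriesˣ)
    {a : Fin 3 → ℤ} (ha : a ∈ f.coeff.support) :
    tropTerm f (tropPoint p) a = -((puiseuxVal (torusTerm f p a) : ℚ) : ℝ) := by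
  rw [torusTerm, puiseuxVal_mul (Finsupp.mem_support_iff.mp ha) (Units.ne_zero _),
    puiseuxVal_prod_zpow]
  simp only [tropTerm, tropPoint]
  push_cast
  rw [neg_add, ← Finset.sum_neg_distrib]
  exact congrArg _ (Finset.sum_congr rfl fun i _ => by ring)

theorem latticePoint_midpoint_mem {Γ : Set (Fin 3 → ℝ)} (hΓ : Convex ℝ Γ) {a b m : Fin 3 → ℤ}
    (ha : latticePoint a ∈ Γ) (hb : latticePoint b ∈ Γ) (hm : m + m = a + b) :
    latticePoint m ∈ Γ := by
  have h : latticePoint m = (1 / 2 : ℝ) • latticePoint a + (1 / 2 : ℝ) • latticePoint b := by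
    ext i
    have := congrArg (fun k : ℤ => (k : ℝ)) (congrFun hm i)
    simp only [Pi.add_apply, Int.cast_add] at this
    simp only [latticePoint, Pi.add_apply, Pi.smul_apply, smul_eq_mul]
    linarith
  rw [h]
  exact hΓ ha hb (by norm_num) (by norm_num) (by norm_num)

/-- If `p` and `q` are the only nodes, a torus translation carrying `p` to `q` is not constant on
six exponents: it would carry `q` to a node as well, and so have order two. -/
theorem false_of_translation_const {F : Type*} [Field F] [CharZero F] {f : LaurentPoly F}
    (hA : AffinelySpans F f.coeff.support) (hcard : f.coeff.support.card = 6)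
    (hmid : ∀ a ∈ f.coeff.support, ∀ b ∈ f.coeff.support, ∀ m : Fin 3 → ℤ, m + m = a + b →
      m ∈ f.coeff.support)
    {p s : Fin 3 → Fˣ} (hnodes : {x | IsNode f x} = {p, p * s}) (hs : s ≠ 1)
    (hconst : ∀ a ∈ f.coeff.support, ∀ b ∈ f.coeff.support,
      ∏ i, s i ^ a i = ∏ i, s i ^ b i) : False := by
  have hp : IsNode f p := hnodes.ge (by simp)
  have hq : IsNode f (p * s) := hnodes.ge (by simp)
  rw [isNode_iff_isNodalWeight] at hp hq
  obtain ⟨a₀, ha₀⟩ : f.coeff.support.Nonempty := Finset.card_pos.mp (by omega)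
  have hqs : IsNode f (p * s * s) := by
    rw [isNode_iff_isNodalWeight]
    refine hq.mul_const (Units.ne_zero (∏ i, s i ^ a₀ i)) fun a ha => ?_
    rw [torusTerm_mul, hconst a ha a₀ ha₀]
  have hmem : p * s * s = p ∨ p * s * s = p * s := hnodes.le hqs
  have hs2 : s * s = 1 := by
    rcases hmem with h | h
    · rwa [mul_assoc, mul_eq_left] at h
    · exact absurd (mul_eq_left.mp h) hs
  exact hp.false_of_character_const hA hcard hmid
    (fun i => by rw [sq]; exact congrFun hs2 i) hs hconst

instance : CharZero PuiseuxSeries :=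
  have : CharZero (HahnSeries ℚ ℂ) :=
    charZero_of_injective_algebraMap (algebraMap ℂ (HahnSeries ℚ ℂ)).injective
  (RingHom.charZero_iff puiseuxSubfield.subtype.injective).mpr this

/-- At either of the two nodes, all terms of `f` have the same valuation. -/
theorem puiseuxVal_torusTerm_eq {f : LaurentPoly PuiseuxSeries}
    (hA : AffinelySpans PuiseuxSeries f.coeff.support) (hcard : f.coeff.support.card ≤ 6)
    (hmid : f.coeff.support.card = 6 → ∀ a ∈ f.coeff.support, ∀ b ∈ f.coeff.support,
      ∀ m : Fin 3 → ℤ, m + m = a + b → m ∈ f.coeff.support)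
    {p q : Fin 3 → PuiseuxSeriesˣ} (hpq : p ≠ q) (hnodes : {x | IsNode f x} = {p, q})
    {a b : Fin 3 → ℤ} (ha : a ∈ f.coeff.support) (hb : b ∈ f.coeff.support) :
    puiseuxVal (torusTerm f p a) = puiseuxVal (torusTerm f p b) := by
  obtain ⟨s, rfl⟩ : ∃ s, q = p * s := ⟨p⁻¹ * q, by rw [mul_inv_cancel_left]⟩
  have hp : IsNode f p := hnodes.ge (by simp)
  have hq : IsNode f (p * s) := hnodes.ge (by simp)
  rw [isNode_iff_isNodalWeight] at hp hq
  rcases hp.ker_le_span_or_proportional hA hcard hq with hspan | ⟨h6, k, hk⟩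
  · obtain ⟨c, hc⟩ := hp.exists_derivation_eq hq hspan s (fun a _ => torusTerm_mul f p s a)
      eulerDerivation eulerDerivation_mul
    exact puiseuxVal_eq_of_eulerDerivation_eq (hp.ne_zero a ha) (hp.ne_zero b hb) (hc a ha)
      (hc b hb)
  · have hconst : ∀ a ∈ f.coeff.support,
        ((∏ i, s i ^ a i : PuiseuxSeriesˣ) : PuiseuxSeries) = k := by
      intro a ha
      have h := hk a ha
      rw [torusTerm_mul, mul_comm k] at h
      exact mul_left_cancel₀ (hp.ne_zero a ha) h
    exact (false_of_translation_const hA h6 (hmid h6) hnodes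
      (fun h => hpq (by rw [h, mul_one]))
      fun a ha b hb => Units.ext ((hconst a ha).trans (hconst b hb).symm)).elim

end Binodal

theorem mainTheorem5
    (Γ : Set (Fin 3 → ℝ)) (hΓ : IsBinodalPolytope PuiseuxSeries Γ)
    (hΓ_six : {a : Fin 3 → ℤ | latticePoint a ∈ Γ}.ncard = 6)
    (f : LaurentPoly PuiseuxSeries) (hf : IsBinodal f) (hfΓ : newtonPolytope f = Γ) :
    ∃ v : Fin 3 → ℝ,
      IsFanWithVertex (tropicalComplex f) v ∧
        ∀ p : Fin 3 → PuiseuxSeriesˣ, IsNode f p → tropPoint p = v := by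
  subst hfΓ
  have hAR : AffinelySpans ℝ f.coeff.support := .of_affineSpan_newtonPolytope hΓ.1
  have hA := hAR.puiseuxSeries
  set L := {a : Fin 3 → ℤ | latticePoint a ∈ newtonPolytope f}
  have hLfin : L.Finite := Set.finite_of_ncard_ne_zero (by omega)
  have hsub : (f.coeff.support : Set (Fin 3 → ℤ)) ⊆ L := fun a ha =>
    subset_convexHull ℝ _ (Set.mem_image_of_mem _ ha)
  have hcard : f.coeff.support.card ≤ 6 := by
    rw [← hΓ_six, ← Set.ncard_coe_finset]
    exact Set.ncard_le_ncard hsub hLfin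
  have hmid : f.coeff.support.card = 6 → ∀ a ∈ f.coeff.support, ∀ b ∈ f.coeff.support,
      ∀ m : Fin 3 → ℤ, m + m = a + b → m ∈ f.coeff.support := by
    intro h6 a ha b hb m hm
    have heq : (f.coeff.support : Set (Fin 3 → ℤ)) = L :=
      Set.eq_of_subset_of_ncard_le hsub (by rw [hΓ_six, Set.ncard_coe_finset, h6]) hLfin
    have hmL : m ∈ L := latticePoint_midpoint_mem (convex_convexHull ℝ _) (hsub ha) (hsub hb) hm
    rwa [← heq] at hmL
  obtain ⟨p, q, hpq, hnodes⟩ := Set.ncard_eq_two.mp hf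
  have htwo : 2 ≤ f.coeff.support.card := by
    have := finrank_ker_momentMap hA hA.nonempty
    omega
  obtain ⟨a₀, ha₀⟩ := hA.nonempty
  have hterm : ∀ {p q}, p ≠ q → {x | IsNode f x} = {p, q} → ∀ a ∈ f.coeff.support,
      tropTerm f (tropPoint p) a = -((puiseuxVal (torusTerm f p a₀) : ℚ) : ℝ) := by
    intro p q hpq hnodes a ha
    rw [tropTerm_tropPoint f p ha, puiseuxVal_torusTerm_eq hA hcard hmid hpq hnodes ha ha₀]
  have hp := hterm hpq hnodes
  have hq := hterm hpq.symm (hnodes.trans (Set.pair_comm p q))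
  refine ⟨tropPoint p, isFanWithVertex_of_tropTerm_eq hAR htwo hp, fun x hx => ?_⟩
  have hx' : x = p ∨ x = q := hnodes.le hx
  rcases hx' with rfl | rfl
  · rfl
  · refine eq_of_dotProduct_const hAR
      (c := tropTerm f (tropPoint x) a₀ - tropTerm f (tropPoint p) a₀) fun a ha => ?_
    rw [hq a₀ ha₀, ← hq a ha, tropTerm_eq_of_apex hp _ ha, hp a₀ ha₀, add_sub_cancel_left]
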